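/- Let $k$ be a field and let $d \ge 1$ and $d'$ be integers with $d+2 \le d' \le 2d+1$. Write $\dim$ for Krull dimension, and for an $\mathbb{N}$-graded ring $R$ let $\dim^{\mathrm{gr}}(R)$ be the supremum of the lengths $r$ of chains $\mathfrak p_0 \subsetneq \cdots \subsetneq \mathfrak p_r$ of homogeneous prime ideals of $R$. An $\mathbb{N}$-graded ring $R=\bigoplus_{n\ge 0}R_n$ with $R_0=k$ is called a Hilbert–Serre ring if $\dim_k R_n<\infty$ for all $n$, its Poincaré series $P_R(t)=\sum_{n\ge 0}(\dim_k R_n)t^n$ has radius of convergence $1$, and for some $e\in\mathbb{N}$ the limit $\lim_{t\to 1^-}(1-t)^eP_R(t)$ exists and is finite. (a) There is an integral domain $A$ containing $k$ with $\dim(A)=d$ and $\dim(A[x])=d'$. (b) For every integral domain $A$ containing $k$ with $\dim(A)=d$ and $\dim(A[x])=d'$, let $R=k\oplus\bigoplus_{n>0}Ax^n\subseteq A[x]$, graded by $R_0=k$ and $R_n=Ax^n$ for $n>0$. Then $R$ is a graded integral domain with $R_0=k$ that is not a Hilbert–Serre ring, and $$\dim^{\mathrm{gr}}(R)=d+1<d'=\dim(R).$$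 In particular, the graded Krull dimension of $R$ is strictly smaller than its Krull dimension. -/

import Mathlib

open Polynomial Topology

universe u v

noncomputable section

/-- The graded Krull dimension: the supremum of the lengths of chains of homogeneous prime
ideals. -/
def gradedKrullDim {k : Type u} {R : Type v} [CommRing k] [CommRing R] [Algebra k R]
    (𝒜 : ℕ → Submodule k R) [GradedAlgebra 𝒜] : WithBot ℕ∞ :=
  Order.krullDim {p : PrimeSpectrum R // p.asIdeal.IsHomogeneous 𝒜}

/-- The value at `t` of the Poincaré series `∑ (dim_k R_n) t ^ n`. -/
def poincareSeries {k : Type u} {R : Type v} [Field k] [CommRing R] [Algebra k R]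
    (𝒜 : ℕ → Submodule k R) (t : ℝ) : ℝ :=
  ∑' n : ℕ, (Module.finrank k (𝒜 n) : ℝ) * t ^ n

/-- Hilbert-Serre rings, among the `ℕ`-graded `k`-algebras with `R_0 = k` a field. -/
structure IsHilbertSerre {k : Type u} {R : Type v} [Field k] [CommRing R] [Algebra k R]
    (𝒜 : ℕ → Submodule k R) [GradedAlgebra 𝒜] : Prop where
  /-- Each graded piece is finite-dimensional. -/
  finite : ∀ n, Module.Finite k (𝒜 n)
  /-- The Poincaré series has radius of convergence `1`. -/
  radius_eq_one :
    (FormalMultilinearSeries.ofScalars ℝ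
      (fun n => (Module.finrank k (𝒜 n) : ℝ))).radius = 1
  /-- For some `d`, the limit of `(1 - t) ^ d * P_R(t)` as `t → 1-` exists and is finite. -/
  exists_pole_order : ∃ (d : ℕ) (l : ℝ),
    Filter.Tendsto (fun t : ℝ => (1 - t) ^ d * poincareSeries 𝒜 t) (𝓝[<] 1) (𝓝 l)

/-- The ring `k ⊕ ⨁_{n > 0} A x ^ n` of the polynomials over `A` whose constant coefficient lies
in `k`, as a `k`-subalgebra of `A[x]`. -/
def constRing (k : Type u) (A : Type v) [Field k] [CommRing A] [Algebra k A] :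
    Subalgebra k A[X] where
  carrier := {f | f.coeff 0 ∈ (algebraMap k A).range}
  mul_mem' {f g} hf hg := by
    simp only [Set.mem_ofPred_eq, mul_coeff_zero] at *
    exact mul_mem hf hg
  add_mem' {f g} hf hg := by
    simp only [Set.mem_ofPred_eq, coeff_add] at *
    exact add_mem hf hg
  algebraMap_mem' c := ⟨c, by simp [Polynomial.algebraMap_apply]⟩

/-- The degree `n` part of `k ⊕ ⨁_{n > 0} A x ^ n`: its elements of the form `a x ^ n`. This is
`k` for `n = 0` and `A x ^ n` for `n > 0`, see `mem_constGrading_zero` and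
`mem_constGrading_pos`. -/
def constGrading (k : Type u) (A : Type v) [Field k] [CommRing A] [Algebra k A] (n : ℕ) :
    Submodule k (constRing k A) where
  carrier := {f | ∃ a : A, (f : A[X]) = monomial n a}
  add_mem' := by
    rintro f g ⟨a, ha⟩ ⟨b, hb⟩
    exact ⟨a + b, by rw [map_add, ← ha, ← hb]; rfl⟩
  zero_mem' := ⟨0, by simp⟩
  smul_mem' := by
    rintro c f ⟨a, ha⟩
    exact ⟨c • a, by rw [← smul_monomial, ← ha]; rfl⟩

section

variable {k : Type u} {A : Type v} [Field k] [CommRing A] [Algebra k A]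

theorem mem_constGrading {n : ℕ} {f : constRing k A} :
    f ∈ constGrading k A n ↔ ∃ a : A, (f : A[X]) = monomial n a := Iff.rfl

theorem mem_constGrading_zero {f : constRing k A} :
    f ∈ constGrading k A 0 ↔ ∃ c : k, f = algebraMap k (constRing k A) c := by
  constructor
  · rintro ⟨a, ha⟩
    obtain ⟨c, hc⟩ := f.2
    refine ⟨c, Subtype.ext ?_⟩
    rw [ha] at hc
    rw [ha]
    have h : algebraMap k A c = a := by simpa using hc
    rw [← h]
    rfl
  · rintro ⟨c, rfl⟩
    exact ⟨algebraMap k A c, rfl⟩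

theorem monomial_mem_constRing {n : ℕ} (hn : 0 < n) (a : A) :
    monomial n a ∈ constRing k A :=
  ⟨0, by simp [coeff_monomial, hn.ne']⟩

theorem mem_constGrading_pos {n : ℕ} (hn : 0 < n) {f : constRing k A} :
    f ∈ constGrading k A n ↔ ∃ a : A, f = ⟨monomial n a, monomial_mem_constRing hn a⟩ := by
  simp only [mem_constGrading, Subtype.ext_iff]

/-- The homogeneous component of degree `n`. -/
def constComponent (n : ℕ) (f : constRing k A) : constGrading k A n :=
  ⟨⟨monomial n ((f : A[X]).coeff n), by
    rcases Nat.eq_zero_or_pos n with rfl | hn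
    · obtain ⟨c, hc⟩ := f.2
      exact ⟨c, by simp [hc]⟩
    · exact monomial_mem_constRing hn _⟩, _, rfl⟩

theorem coeff_coeAddMonoidHom_constGrading
    (x : DirectSum ℕ fun n => constGrading k A n) (n : ℕ) :
    ((DirectSum.coeAddMonoidHom (constGrading k A) x : constRing k A) : A[X]).coeff n =
      ((x n : constRing k A) : A[X]).coeff n := by
  induction x using DirectSum.induction_on with
  | zero => simp
  | of i y =>
    obtain ⟨a, ha⟩ := y.2
    rw [DirectSum.coeAddMonoidHom_of]
    by_cases h : i = n
    · subst h
      rw [DirectSum.of_eq_same]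
    · rw [DirectSum.of_eq_of_ne _ _ _ (Ne.symm h), ha, coeff_monomial, if_neg h]
      simp
  | add x y hx hy => simp [hx, hy]

/-- `k ⊕ ⨁_{n > 0} A x ^ n` is a graded `k`-algebra. -/
instance constGradedAlgebra : GradedAlgebra (constGrading k A) where
  one_mem := ⟨1, by simp⟩
  mul_mem := by
    rintro i j f g ⟨a, ha⟩ ⟨b, hb⟩
    exact ⟨a * b, by simp [ha, hb, monomial_mul_monomial]⟩
  decompose' f := DirectSum.mk (fun n => constGrading k A n) (f : A[X]).support
    fun n => constComponent n f
  left_inv f := by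
    apply Subtype.ext
    ext n
    rw [coeff_coeAddMonoidHom_constGrading]
    by_cases hn : n ∈ (f : A[X]).support
    · rw [DirectSum.mk_apply_of_mem hn]
      simp [constComponent]
    · rw [DirectSum.mk_apply_of_notMem hn, notMem_support_iff.mp hn]
      simp
  right_inv x := by
    apply DFinsupp.ext
    intro n
    have key := coeff_coeAddMonoidHom_constGrading x n
    obtain ⟨a, ha⟩ := (x n).2
    apply Subtype.ext
    apply Subtype.ext
    by_cases hn : n ∈ ((DirectSum.coeAddMonoidHom (constGrading k A) x :
        constRing k A) : A[X]).support
    · rw [DirectSum.mk_apply_of_mem hn]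
      simp [constComponent, key, ha]
    · rw [DirectSum.mk_apply_of_notMem hn]
      rw [notMem_support_iff, key, ha] at hn
      rw [ha]
      have h : a = 0 := by simpa using hn
      simp [h]

end

end

/-!
The ring `R = k ⊕ ⨁_{n > 0} A x ^ n` contains the ideal `x A[x]`, so contraction identifies the
primes of `A[x]` avoiding `x` with those of `R` avoiding `x`, while the only prime of `R` containing
`x` is the irrelevant ideal, which is maximal. The substitution `x ↦ x + 1` moves a prime of `A[x]`
containing `x` to one that does not, so no chain length is lost and `dim R = dim A[x]`. The
homogeneous primes of `R` avoiding `x` are the `q[x] ∩ R` for `q` a prime of `A`; together with the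
irrelevant ideal they give graded dimension `dim A + 1`. Finally `A` has positive dimension, hence
is not finite over `k`, and neither is `R₁ ≅ A`.

Seidenberg's examples come from the same kind of subring. Given a domain `D` and a field extension
`L` of its fraction field containing an element `s` transcendental over `D`, the power series over
`L` with constant coefficient in `D` form a ring whose nonzero primes are those containing `L⟦t⟧ t`,
so that `dim` goes up by one. Over the zero ideal, evaluation at a power series with constant
coefficient `s` provides one further prime of the polynomial ring, whose dimension thus goes up by
two. Starting from `k[x₁, …, x_m]`, where the polynomial ring has dimension `m + 1`, and iterating
reaches all pairs `(d, d')`.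
-/

section KrullDim

variable {P Q : Type*} [Preorder P] [Preorder Q]

theorem krullDim_eq_add_one_of_forall_lt [Nonempty Q] (ι : Q ↪o P) (c : P) (hc : ∀ q, c < ι q)
    (hmin : ∀ p ∉ Set.range ι, IsMin p) : Order.krullDim P = Order.krullDim Q + 1 := by
  classical
  rw [← Order.krullDim_withBot]
  apply le_antisymm
  · refine Order.krullDim_le_of_strictMono
      (fun p => if hp : p ∈ Set.range ι then (hp.choose : WithBot Q) else ⊥) fun p p' hpp' => ?_
    have hp' : p' ∈ Set.range ι := by
      by_contra hp'
      exact (hmin p' hp').not_lt hpp'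
    by_cases hp : p ∈ Set.range ι
    · simp only [dif_pos hp, dif_pos hp', WithBot.coe_lt_coe, ← ι.lt_iff_lt, hp.choose_spec,
        hp'.choose_spec, hpp']
    · simp only [dif_neg hp, dif_pos hp', WithBot.bot_lt_coe]
  · refine Order.krullDim_le_of_strictMono (fun q : WithBot Q => q.recBotCoe c ι) ?_
    rintro (_ | q) (_ | q') hqq'
    · exact absurd hqq' (lt_irrefl _)
    · exact hc q'
    · exact absurd hqq' not_lt_bot
    · exact ι.strictMono (WithBot.coe_lt_coe.mp hqq')

theorem krullDim_eq_add_one_of_forall_gt [Nonempty Q] (ι : Q ↪o P) (c : P) (hc : ∀ q, ι q < c)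
    (hmax : ∀ p ∉ Set.range ι, IsMax p) : Order.krullDim P = Order.krullDim Q + 1 := by
  rw [← Order.krullDim_orderDual (α := P), ← Order.krullDim_orderDual (α := Q)]
  exact krullDim_eq_add_one_of_forall_lt ι.dual (OrderDual.toDual c) hc hmax

theorem krullDim_le_of_strictMono_of_not_isMax [Nonempty Q] (f : {p : P // ¬IsMax p} → Q)
    (hf : StrictMono f) (hmax : ∀ p, ¬IsMax (f p)) : Order.krullDim P ≤ Order.krullDim Q := by
  refine iSup_le fun s => ?_
  by_cases h0 : s.length = 0
  · rw [h0]
    exact Order.krullDim_nonneg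
  let s' : LTSeries P := s.eraseLast
  have not_isMax (i : Fin s'.length.succ) : ¬IsMax (s' i) := fun hi =>
    hi.not_lt ((s'.monotone (Fin.le_last i)).trans_lt (s.eraseLast_last_rel_last h0))
  let t : LTSeries Q := LTSeries.mk s'.length (fun i => f ⟨s' i, not_isMax i⟩)
    fun _ _ hij => hf (s'.strictMono hij)
  obtain ⟨q, hq⟩ := not_isMax_iff.mp (hmax ⟨s'.last, not_isMax _⟩)
  have length_snoc : (t.snoc q hq).length = s.length :=
    (RelSeries.snoc_length t q hq).trans (Nat.succ_pred h0)
  rw [← length_snoc]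
  exact Order.LTSeries.length_le_krullDim _

theorem krullDim_le_krullDim_of_forall_exists_mem_lowerSet (U : LowerSet P)
    (h : ∀ p, ∃ e : P ≃o P, e p ∈ U) : Order.krullDim P ≤ Order.krullDim U := by
  refine iSup_le fun s => ?_
  obtain ⟨e, he⟩ := h s.last
  exact Order.LTSeries.length_le_krullDim <| LTSeries.mk s.length
    (fun i => (⟨e (s i), U.lower (e.monotone (s.monotone (Fin.le_last i))) he⟩ : U))
    fun _ _ hij => e.strictMono (s.strictMono hij)

end KrullDim

section Conductor

variable {R S : Type*} [CommRing R] [CommRing S] [Algebra R S] {x : R}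

theorem mem_of_algebraMap_eq_mul [FaithfulSMul R S]
    (hx : ∀ s : S, algebraMap R S x * s ∈ (algebraMap R S).range) {p : Ideal R} [p.IsPrime]
    (hxp : x ∈ p) {r : R} {s : S} (hr : algebraMap R S r = algebraMap R S x * s) : r ∈ p := by
  obtain ⟨r', hr'⟩ := hx (s ^ 2)
  have sq_eq : r ^ 2 = x * r' := by
    apply FaithfulSMul.algebraMap_injective R S
    rw [map_pow, map_mul, hr, hr']
    ring
  refine Ideal.IsPrime.mem_of_pow_mem ‹_› 2 ?_
  rw [sq_eq]
  exact p.mul_mem_right _ hxp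

theorem comap_algebraMap_le_comap_iff
    (hx : ∀ s : S, algebraMap R S x * s ∈ (algebraMap R S).range) {P Q : Ideal S} [hQ : Q.IsPrime]
    (hxQ : algebraMap R S x ∉ Q) :
    P.comap (algebraMap R S) ≤ Q.comap (algebraMap R S) ↔ P ≤ Q := by
  refine ⟨fun h s hs => ?_, fun h => Ideal.comap_mono h⟩
  obtain ⟨r, hr⟩ := hx s
  have hrP : r ∈ P.comap (algebraMap R S) := by
    rw [Ideal.mem_comap, hr]
    exact P.mul_mem_left _ hs
  have hrQ : algebraMap R S x * s ∈ Q := hr ▸ h hrP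
  exact (hQ.mem_or_mem hrQ).resolve_left hxQ

theorem exists_isPrime_comap_algebraMap_eq [FaithfulSMul R S]
    (hx : ∀ s : S, algebraMap R S x * s ∈ (algebraMap R S).range) {p : Ideal R} [hp : p.IsPrime]
    (hxp : x ∉ p) : ∃ P : Ideal S, P.IsPrime ∧ P.comap (algebraMap R S) = p := by
  refine (Ideal.comap_map_eq_self_iff_of_isPrime p).mp
    (le_antisymm (fun r hr => ?_) Ideal.le_comap_map)
  have mul_mem_image (s : S) (hs : s ∈ p.map (algebraMap R S)) :
      ∀ a : S, ∃ r ∈ p, algebraMap R S r = algebraMap R S x * (a * s) := by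
    induction hs using Submodule.span_induction with
    | mem s hs =>
      obtain ⟨b, hb, rfl⟩ := hs
      intro a
      obtain ⟨c, hc⟩ := hx a
      exact ⟨c * b, p.mul_mem_left c hb, by rw [map_mul, hc, mul_assoc]⟩
    | zero => exact fun a => ⟨0, p.zero_mem, by simp⟩
    | add s t _ _ hs ht =>
      intro a
      obtain ⟨b, hb, hb'⟩ := hs a
      obtain ⟨c, hc, hc'⟩ := ht a
      exact ⟨b + c, p.add_mem hb hc, by rw [map_add, hb', hc', mul_add, mul_add]⟩
    | smul c s _ hs =>
      intro a
      obtain ⟨b, hb, hb'⟩ := hs (a * c)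
      exact ⟨b, hb, by rw [hb', smul_eq_mul, mul_assoc]⟩
  obtain ⟨b, hb, hb'⟩ := mul_mem_image _ hr 1
  have hbr : b = x * r := by
    apply FaithfulSMul.algebraMap_injective R S
    rw [hb', one_mul, map_mul]
  exact (hp.mem_or_mem (hbr ▸ hb)).resolve_left hxp

theorem isMaximal_comap_algebraMap
    (hx : ∀ s : S, algebraMap R S x * s ∈ (algebraMap R S).range) {P : Ideal S} [hP : P.IsMaximal]
    (hxP : algebraMap R S x ∉ P) : (P.comap (algebraMap R S)).IsMaximal := by
  let := Ideal.Quotient.field P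
  let π := Ideal.Quotient.mk P
  have surjective : Function.Surjective (π.comp (algebraMap R S)) := by
    intro z
    have hx0 : π (algebraMap R S x) ≠ 0 := Ideal.Quotient.eq_zero_iff_mem.not.mpr hxP
    obtain ⟨s, hs⟩ := Ideal.Quotient.mk_surjective ((π (algebraMap R S x))⁻¹ * z)
    obtain ⟨r, hr⟩ := hx s
    refine ⟨r, ?_⟩
    rw [RingHom.comp_apply, hr, map_mul, hs, mul_inv_cancel_left₀ hx0]
  have := RingHom.ker_isMaximal_of_surjective _ surjective
  rwa [← RingHom.comap_ker, Ideal.mk_ker] at this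

/-- Primes of `S` and of a subring `R` that avoid an element `x` of `R` correspond to each other by
contraction, provided that `R` contains `x S`. -/
noncomputable def comapNotMemOrderIso [FaithfulSMul R S]
    (hx : ∀ s : S, algebraMap R S x * s ∈ (algebraMap R S).range) :
    {P : PrimeSpectrum S // algebraMap R S x ∉ P.asIdeal} ≃o
      {p : PrimeSpectrum R // x ∉ p.asIdeal} :=
  RelIso.ofSurjective
    (OrderEmbedding.ofMapLEIff (fun P => ⟨P.1.comap (algebraMap R S), P.2⟩)
      fun _ Q => comap_algebraMap_le_comap_iff hx Q.2) <| by
    rintro ⟨p, hxp⟩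
    obtain ⟨P, hP, hPp⟩ := exists_isPrime_comap_algebraMap_eq hx hxp
    exact ⟨⟨⟨P, hP⟩, fun h => hxp (hPp ▸ h)⟩, Subtype.ext (PrimeSpectrum.ext hPp)⟩

theorem comap_comapNotMemOrderIso_symm [FaithfulSMul R S]
    (hx : ∀ s : S, algebraMap R S x * s ∈ (algebraMap R S).range)
    (p : {p : PrimeSpectrum R // x ∉ p.asIdeal}) :
    ((comapNotMemOrderIso hx).symm p).1.comap (algebraMap R S) = p.1 :=
  congrArg Subtype.val ((comapNotMemOrderIso hx).apply_symm_apply p)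

theorem krullDim_notMem_le_ringKrullDim [FaithfulSMul R S]
    (hx : ∀ s : S, algebraMap R S x * s ∈ (algebraMap R S).range) :
    Order.krullDim {P : PrimeSpectrum S // algebraMap R S x ∉ P.asIdeal} ≤ ringKrullDim R := by
  rw [Order.krullDim_eq_of_orderIso (comapNotMemOrderIso hx)]
  exact Order.krullDim_le_of_strictMono _ (Subtype.strictMono_coe _)

theorem ringKrullDim_le_of_forall_isMaximal [FaithfulSMul R S] [Nontrivial S]
    (hx : ∀ s : S, algebraMap R S x * s ∈ (algebraMap R S).range)
    (hmax : ∀ p : Ideal R, p.IsPrime → x ∈ p → p.IsMaximal) :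
    ringKrullDim R ≤ ringKrullDim S := by
  have hxp (p : {p : PrimeSpectrum R // ¬IsMax p}) : x ∉ p.1.asIdeal := fun h =>
    p.2 (PrimeSpectrum.isMax_iff.mpr (hmax _ p.1.isPrime h))
  refine krullDim_le_of_strictMono_of_not_isMax
    (fun p => ((comapNotMemOrderIso hx).symm ⟨p.1, hxp p⟩).1) (fun p q hpq => ?_) fun p h => p.2 ?_
  · exact (comapNotMemOrderIso hx).symm.strictMono hpq
  · have := PrimeSpectrum.isMax_iff.mp h
    rw [PrimeSpectrum.isMax_iff, ← comap_comapNotMemOrderIso_symm hx ⟨p.1, hxp p⟩]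
    exact isMaximal_comap_algebraMap hx ((comapNotMemOrderIso hx).symm _).2

end Conductor

section Surjective

variable {R S : Type*} [CommRing R] [CommRing S] {f : R →+* S}

/-- The closed immersion `Spec S → Spec R` given by a surjection `R → S`, as an embedding of
ordered sets. -/
def specOrderEmbeddingOfSurjective (hf : Function.Surjective f) :
    PrimeSpectrum S ↪o PrimeSpectrum R :=
  OrderEmbedding.ofMapLEIff (PrimeSpectrum.comap f) fun p q =>
    Ideal.comap_le_comap_iff_of_surjective f hf p.asIdeal q.asIdeal

theorem mem_range_specOrderEmbeddingOfSurjective (hf : Function.Surjective f)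
    {p : PrimeSpectrum R} :
    p ∈ Set.range (specOrderEmbeddingOfSurjective hf) ↔ RingHom.ker f ≤ p.asIdeal :=
  Set.ext_iff.mp (range_comap_of_surjective S f hf) p

theorem ker_le_specOrderEmbeddingOfSurjective (hf : Function.Surjective f) (q : PrimeSpectrum S) :
    RingHom.ker f ≤ (specOrderEmbeddingOfSurjective hf q).asIdeal :=
  (mem_range_specOrderEmbeddingOfSurjective hf).mp ⟨q, rfl⟩

theorem ringKrullDim_eq_add_one_of_ker_le [IsDomain R] [Nontrivial S]
    (hf : Function.Surjective f) (hf0 : RingHom.ker f ≠ ⊥)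
    (hker : ∀ p : Ideal R, p.IsPrime → p ≠ ⊥ → RingHom.ker f ≤ p) :
    ringKrullDim R = ringKrullDim S + 1 := by
  refine krullDim_eq_add_one_of_forall_lt (specOrderEmbeddingOfSurjective hf) ⊥
    (fun q => (PrimeSpectrum.asIdeal_lt_asIdeal _ _).mp ?_) fun p hp => ?_
  · exact (bot_lt_iff_ne_bot.mpr hf0).trans_le (ker_le_specOrderEmbeddingOfSurjective hf q)
  · have p_eq_bot : p.asIdeal = ⊥ := by
      by_contra h
      exact hp ((mem_range_specOrderEmbeddingOfSurjective hf).mpr (hker _ p.isPrime h))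
    exact isMin_iff_eq_bot.mpr (PrimeSpectrum.ext p_eq_bot)

end Surjective

section Polynomial

variable {R S : Type*} [CommRing R] [IsDomain R] [CommRing S] {f : R →+* S}

/- Such a prime lies in the fibre of `Spec R[X] → Spec R` over `0`, which is the spectrum of
polynomials over the fraction field and hence one-dimensional. -/
theorem eq_bot_of_lt_of_comap_C_eq_bot {p q : PrimeSpectrum R[X]} (hpq : p < q)
    (hq : q.comap C = ⊥) : p = ⊥ := by
  have hp : p.comap C = ⊥ := le_bot_iff.mp (hq ▸ Ideal.comap_mono hpq.le)
  have hbot : (⊥ : PrimeSpectrum R[X]).comap C = ⊥ :=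
    le_bot_iff.mp (hp ▸ Ideal.comap_mono (bot_le (a := p)))
  have fibre_le_one : Order.krullDim (PrimeSpectrum.comap (algebraMap R R[X]) ⁻¹' {⊥}) ≤ 1 := by
    rw [Order.krullDim_eq_of_orderIso (PrimeSpectrum.preimageOrderIsoFiber R R[X] ⊥),
      ← ringKrullDim, ← ringKrullDim_eq_of_ringEquiv
        (polyEquivTensor R ((⊥ : PrimeSpectrum R).asIdeal.ResidueField)).toRingEquiv]
    exact Ring.krullDimLE_iff.mp inferInstance
  rcases (Order.krullDim_le_one_iff.mp fibre_le_one) ⟨p, hp⟩ with hmin | hmax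
  · exact le_bot_iff.mp (hmin (b := ⟨⊥, hbot⟩) (bot_le (a := p)))
  · exact absurd (hmax (b := ⟨q, hq⟩) hpq.le) hpq.not_ge

theorem comap_C_eq_bot_of_not_ker_mapRingHom_le
    (hker : ∀ p : Ideal R, p.IsPrime → p ≠ ⊥ → RingHom.ker f ≤ p) {p : PrimeSpectrum R[X]}
    (hp : ¬RingHom.ker (mapRingHom f) ≤ p.asIdeal) : p.comap C = ⊥ := by
  by_contra hp0
  refine hp fun g hg => Ideal.polynomial_mem_ideal_of_coeff_mem_ideal p.asIdeal g fun n => ?_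
  refine hker _ (p.comap C).isPrime (fun h => hp0 (PrimeSpectrum.ext h)) ?_
  rw [RingHom.mem_ker, ← coeff_map, ← coe_mapRingHom, RingHom.mem_ker.mp hg, coeff_zero]

theorem ringKrullDim_polynomial_eq_add_two_of_ker_le [Nontrivial S]
    (hf : Function.Surjective f)
    (hker : ∀ p : Ideal R, p.IsPrime → p ≠ ⊥ → RingHom.ker f ≤ p)
    {q : Ideal R[X]} [hq : q.IsPrime] (hq0 : q ≠ ⊥) (hqf : q < RingHom.ker (mapRingHom f)) :
    ringKrullDim R[X] = ringKrullDim S[X] + 2 := by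
  have map_surj : Function.Surjective (mapRingHom f) := map_surjective f hf
  let ι := specOrderEmbeddingOfSurjective map_surj
  let q' : {p : PrimeSpectrum R[X] // p ≠ ⊥} :=
    ⟨⟨q, hq⟩, fun h => hq0 (congrArg PrimeSpectrum.asIdeal h)⟩
  have q_lt (p : PrimeSpectrum S[X]) : q'.1 < ι p :=
    hqf.trans_le (ker_le_specOrderEmbeddingOfSurjective _ p)
  let ι' : PrimeSpectrum S[X] ↪o {p : PrimeSpectrum R[X] // p ≠ ⊥} :=
    OrderEmbedding.ofMapLEIff (fun p => ⟨ι p, (q_lt p).ne_bot⟩) fun _ _ => ι.le_iff_le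
  have dim_ne_bot : Order.krullDim {p : PrimeSpectrum R[X] // p ≠ ⊥} = ringKrullDim S[X] + 1 := by
    refine krullDim_eq_add_one_of_forall_lt ι' q' q_lt fun p hp => ?_
    have comap_eq_bot : p.1.comap C = ⊥ := by
      refine comap_C_eq_bot_of_not_ker_mapRingHom_le hker fun hle => hp ?_
      obtain ⟨p', hp'⟩ := (mem_range_specOrderEmbeddingOfSurjective map_surj).mpr hle
      exact ⟨p', Subtype.ext hp'⟩
    exact isMin_iff_forall_not_lt.mpr fun r hrp =>
      r.2 (eq_bot_of_lt_of_comap_C_eq_bot hrp comap_eq_bot)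
  have : Nonempty {p : PrimeSpectrum R[X] // p ≠ ⊥} := ⟨q'⟩
  rw [ringKrullDim, krullDim_eq_add_one_of_forall_lt (OrderEmbedding.subtype (· ≠ ⊥)) ⊥
    (fun p => bot_lt_iff_ne_bot.mpr p.2), dim_ne_bot, add_assoc, one_add_one_eq_two]
  intro p hp
  rw [isMin_iff_eq_bot]
  by_contra h
  exact hp ⟨⟨p, h⟩, rfl⟩

end Polynomial

section ComapSubalgebra

variable {k V L : Type*} [CommRing k] [CommRing V] [Field L] [Algebra k V] [Algebra k L]
  (π : V →ₐ[k] L) (D : Subalgebra k L)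

/-- The restriction of `π : V → L` to a map `π⁻¹(D) → D`, for a subalgebra `D` of `L`. When `V`
is a valuation ring with residue field `L`, the ring `π⁻¹(D)` is the classical `D + M`
construction. -/
def comapRestrict : D.comap π →+* D :=
  ((π.comp (D.comap π).val).codRestrict D fun a => a.2).toRingHom

variable {π D}

theorem mem_ker_comapRestrict {a : D.comap π} :
    a ∈ RingHom.ker (comapRestrict π D) ↔ π a = 0 :=
  RingHom.mem_ker.trans Subtype.ext_iff

theorem comapRestrict_surjective (hπ : Function.Surjective π) :
    Function.Surjective (comapRestrict π D) := by
  rintro ⟨d, hd⟩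
  obtain ⟨v, rfl⟩ := hπ d
  exact ⟨⟨v, hd⟩, rfl⟩

theorem mul_mem_range_of_mem_ker_comapRestrict {t : D.comap π}
    (ht : t ∈ RingHom.ker (comapRestrict π D)) (v : V) :
    algebraMap (D.comap π) V t * v ∈ (algebraMap (D.comap π) V).range := by
  have π_mul : π (t * v) = 0 := by rw [map_mul, mem_ker_comapRestrict.mp ht, zero_mul]
  exact ⟨⟨t * v, (π_mul ▸ D.zero_mem : π (t * v) ∈ D)⟩, rfl⟩

theorem exists_mem_ker_comapRestrict_ne_zero (hπ0 : RingHom.ker π ≠ ⊥) :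
    ∃ t ∈ RingHom.ker (comapRestrict π D), t ≠ 0 := by
  obtain ⟨v, hv, hv0⟩ := Submodule.exists_mem_ne_zero_of_ne_bot hπ0
  refine ⟨⟨v, ?_⟩, mem_ker_comapRestrict.mpr hv, fun h => hv0 (congrArg Subtype.val h)⟩
  rw [Subalgebra.mem_comap, RingHom.mem_ker.mp hv]
  exact D.zero_mem

theorem ker_aeval_le_ker_mapRingHom_comapRestrict {v : V} (hv : Transcendental D (π v)) :
    RingHom.ker (aeval v : (D.comap π)[X] →ₐ[D.comap π] V) ≤
      RingHom.ker (mapRingHom (comapRestrict π D)) := by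
  intro g hg
  have aeval_map : aeval (π v) (g.map (comapRestrict π D)) = π (aeval v g) := by
    rw [aeval_def, aeval_def, eval₂_map, ← AlgHom.coe_toRingHom, hom_eval₂]
    rfl
  refine RingHom.mem_ker.mpr (transcendental_iff.mp hv _ ?_)
  rw [coe_mapRingHom, aeval_map, RingHom.mem_ker.mp hg, map_zero]

variable [IsLocalRing V] [Ring.DimensionLEOne V]

theorem ker_comapRestrict_le (hπ : Function.Surjective π) (p : Ideal (D.comap π))
    (hp : p.IsPrime) (hp0 : p ≠ ⊥) : RingHom.ker (comapRestrict π D) ≤ p := by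
  intro t ht
  by_contra htp
  obtain ⟨P, hP, rfl⟩ :=
    exists_isPrime_comap_algebraMap_eq (S := V) (mul_mem_range_of_mem_ker_comapRestrict ht) htp
  have P_ne_bot : P ≠ ⊥ := by
    rintro rfl
    exact hp0 (Ideal.comap_bot_of_injective _ Subtype.val_injective)
  have P_eq_ker : P = RingHom.ker π := by
    rw [IsLocalRing.eq_maximalIdeal (hP.isMaximal P_ne_bot)]
    exact (IsLocalRing.ker_eq_maximalIdeal (π : V →+* L) hπ).symm
  exact htp (P_eq_ker ▸ mem_ker_comapRestrict.mp ht)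

variable [IsDomain V]

theorem ringKrullDim_comap_subalgebra (hπ : Function.Surjective π) (hπ0 : RingHom.ker π ≠ ⊥) :
    ringKrullDim (D.comap π) = ringKrullDim D + 1 := by
  refine ringKrullDim_eq_add_one_of_ker_le (comapRestrict_surjective hπ) ?_
    (ker_comapRestrict_le hπ)
  obtain ⟨t, ht, ht0⟩ := exists_mem_ker_comapRestrict_ne_zero (D := D) hπ0
  exact (Submodule.ne_bot_iff _).mpr ⟨t, ht, ht0⟩

theorem ringKrullDim_polynomial_comap_subalgebra (hπ : Function.Surjective π)
    (hπ0 : RingHom.ker π ≠ ⊥) {s : L} (hs : Transcendental D s) :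
    ringKrullDim (D.comap π)[X] = ringKrullDim D[X] + 2 := by
  obtain ⟨t, ht, ht0⟩ := exists_mem_ker_comapRestrict_ne_zero (D := D) hπ0
  obtain ⟨v, rfl⟩ := hπ s
  let q := RingHom.ker (aeval v : (D.comap π)[X] →ₐ[D.comap π] V)
  have q_prime : q.IsPrime := RingHom.ker_isPrime _
  have C_mem : C t ∈ RingHom.ker (mapRingHom (comapRestrict π D)) := by
    rw [RingHom.mem_ker, coe_mapRingHom, map_C, RingHom.mem_ker.mp ht, C_0]
  have C_notMem : C t ∉ q := by
    rw [RingHom.mem_ker, aeval_C]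
    exact fun h => ht0 (Subtype.ext h)
  refine ringKrullDim_polynomial_eq_add_two_of_ker_le (comapRestrict_surjective hπ)
    (ker_comapRestrict_le hπ) (q := q) (fun h => ?_)
    (lt_of_le_not_ge (ker_aeval_le_ker_mapRingHom_comapRestrict hs) fun h => C_notMem (h C_mem))
  obtain ⟨u, hu⟩ := mul_mem_range_of_mem_ker_comapRestrict ht v
  have linear_mem : C t * X - C u ∈ q := by
    rw [RingHom.mem_ker, map_sub, map_mul, aeval_C, aeval_C, aeval_X, hu, sub_self]
  rw [h, Ideal.mem_bot] at linear_mem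
  have coeff_one : (C t * X - C u).coeff 1 = t := by
    rw [coeff_sub, coeff_C_mul, coeff_X_one, mul_one, coeff_C_succ, sub_zero]
  exact ht0 (by rw [← coeff_one, linear_mem, coeff_zero])

end ComapSubalgebra

section Seidenberg

theorem exists_ringKrullDim_add_one_and_add_two (k : Type*) (D : Type u) [CommRing k]
    [CommRing D] [IsDomain D] [Algebra k D] :
    ∃ (A : Type u) (_ : CommRing A) (_ : IsDomain A) (_ : Algebra k A),
      ringKrullDim A = ringKrullDim D + 1 ∧ ringKrullDim A[X] = ringKrullDim D[X] + 2 := by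
  let L := FractionRing D[X]
  let i : D →ₐ[k] L := IsScalarTower.toAlgHom k D L
  let e : D ≃ₐ[k] i.range := AlgEquiv.ofInjective i (FaithfulSMul.algebraMap_injective D L)
  let π : PowerSeries L →ₐ[k] L :=
    { PowerSeries.constantCoeff (R := L) with
      commutes' := fun c => PowerSeries.constantCoeff_C (algebraMap k L c) }
  have hπ : Function.Surjective π := PowerSeries.constantCoeff_surj
  have hπ0 : RingHom.ker π ≠ ⊥ := fun h =>
    PowerSeries.X_ne_zero (R := L) (h.le (PowerSeries.constantCoeff_X (R := L)))
  have hX : Transcendental D (algebraMap D[X] L X) :=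
    (transcendental_algebraMap_iff (IsFractionRing.injective D[X] L)).mpr
      (Polynomial.transcendental_X D)
  have hX' : Transcendental i.range (algebraMap D[X] L X) :=
    hX.ringHom_of_comp_eq (e : D →+* i.range) (RingHom.id L) e.surjective
      Function.injective_id rfl
  refine ⟨i.range.comap π, inferInstance, inferInstance, inferInstance, ?_, ?_⟩
  · rw [ringKrullDim_comap_subalgebra hπ hπ0, ringKrullDim_eq_of_ringEquiv e.toRingEquiv]
  · rw [ringKrullDim_polynomial_comap_subalgebra hπ hπ0 hX',
      ringKrullDim_eq_of_ringEquiv (mapEquiv e.toRingEquiv)]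

theorem exists_ringKrullDim_eq_and_ringKrullDim_polynomial_eq (k : Type u) [Field k] (m j : ℕ) :
    ∃ (A : Type u) (_ : CommRing A) (_ : IsDomain A) (_ : Algebra k A),
      ringKrullDim A = (m + j : ℕ) ∧ ringKrullDim A[X] = (m + 1 + 2 * j : ℕ) := by
  induction j with
  | zero =>
    have dim_mvPolynomial : ringKrullDim (MvPolynomial (Fin m) k) = (m : ℕ) := by simp
    refine ⟨MvPolynomial (Fin m) k, inferInstance, inferInstance, inferInstance,
      dim_mvPolynomial, ?_⟩
    rw [Polynomial.ringKrullDim_of_isNoetherianRing, dim_mvPolynomial]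
    rfl
  | succ j ih =>
    obtain ⟨D, _, _, _, dim_D, dim_polynomial_D⟩ := ih
    obtain ⟨A, hA, hA', hA'', dim_A, dim_polynomial_A⟩ :=
      exists_ringKrullDim_add_one_and_add_two k D
    refine ⟨A, hA, hA', hA'', ?_, ?_⟩
    · rw [dim_A, dim_D]
      rfl
    · rw [dim_polynomial_A, dim_polynomial_D]
      rfl

end Seidenberg

section IrrelevantIdeal

variable {ι R σ : Type*} [DecidableEq ι] [AddCommMonoid ι] [PartialOrder ι]
  [CanonicallyOrderedAdd ι] [CommRing R] [SetLike σ R] [AddSubgroupClass σ R] (𝒜 : ι → σ)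
  [GradedRing 𝒜]

theorem isMaximal_irrelevant_of_isField (h : IsField (𝒜 0)) :
    (HomogeneousIdeal.irrelevant 𝒜).toIdeal.IsMaximal := by
  have irrelevant_eq_ker : (HomogeneousIdeal.irrelevant 𝒜).toIdeal =
      RingHom.ker (GradedRing.projZeroRingHom' 𝒜) := by
    ext f
    rw [RingHom.mem_ker, ← ZeroMemClass.coe_eq_zero]
    rfl
  let := h.toField
  rw [irrelevant_eq_ker]
  exact RingHom.ker_isMaximal_of_surjective _ (GradedRing.projZeroRingHom'_surjective 𝒜)

theorem le_irrelevant_of_isHomogeneous_of_isField (h : IsField (𝒜 0)) {I : Ideal R}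
    (hI : I.IsHomogeneous 𝒜) (hI' : I ≠ ⊤) : I ≤ (HomogeneousIdeal.irrelevant 𝒜).toIdeal := by
  intro f hf
  change ((DirectSum.decompose 𝒜 f 0 : 𝒜 0) : R) = 0
  by_contra hf0
  obtain ⟨b, hb⟩ := h.mul_inv_cancel fun hf0' => hf0 (congrArg Subtype.val hf0')
  refine hI' ((Ideal.eq_top_iff_one I).mpr ?_)
  have mul_mem : ((DirectSum.decompose 𝒜 f 0 : 𝒜 0) : R) * b ∈ I := I.mul_mem_right _ (hI 0 hf)
  rwa [← SetLike.GradeZero.coe_mul, hb] at mul_mem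

end IrrelevantIdeal

section PolynomialX

variable {A : Type*} [CommRing A]

theorem ringKrullDim_polynomial_le_krullDim_X_notMem :
    ringKrullDim A[X] ≤ Order.krullDim {P : PrimeSpectrum A[X] // X ∉ P.asIdeal} := by
  let U : LowerSet (PrimeSpectrum A[X]) :=
    ⟨{P | X ∉ P.asIdeal}, fun _ _ hQP hXP hXQ => hXP (hQP hXQ)⟩
  refine krullDim_le_krullDim_of_forall_exists_mem_lowerSet U fun P => ?_
  by_cases hX : X ∈ P.asIdeal
  · refine ⟨(PrimeSpectrum.comapEquiv (taylorEquiv (1 : A)).toRingEquiv).symm, fun h => ?_⟩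
    have X_add_one_mem : X + C 1 ∈ P.asIdeal := taylor_X (1 : A) ▸ h
    refine P.isPrime.ne_top ((Ideal.eq_top_iff_one _).mpr ?_)
    simpa using P.asIdeal.sub_mem X_add_one_mem hX
  · exact ⟨OrderIso.refl _, hX⟩

end PolynomialX

namespace constRing

variable {k : Type u} {A : Type v} [Field k] [CommRing A] [Algebra k A]

/-- The element `x` of `k ⊕ ⨁_{n > 0} A x ^ n`. -/
noncomputable def var : constRing k A := ⟨X, 0, by simp⟩

theorem algebraMap_var_mul_mem_range (f : A[X]) :
    algebraMap (constRing k A) A[X] var * f ∈ (algebraMap (constRing k A) A[X]).range :=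
  ⟨⟨X * f, 0, by simp⟩, rfl⟩

theorem coe_decompose (f : constRing k A) (n : ℕ) :
    ((DirectSum.decompose (constGrading k A) f n : constRing k A) : A[X]) =
      monomial n ((f : A[X]).coeff n) := by
  obtain ⟨a, ha⟩ := (DirectSum.decompose (constGrading k A) f n).2
  have coeff_eq := coeff_coeAddMonoidHom_constGrading (DirectSum.decompose (constGrading k A) f) n
  rw [show DirectSum.coeAddMonoidHom (constGrading k A)
    (DirectSum.decompose (constGrading k A) f) = f from DirectSum.Decomposition.left_inv f, ha,
    coeff_monomial_same] at coeff_eq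
  rw [ha, coeff_eq]

theorem mem_irrelevant_iff {f : constRing k A} :
    f ∈ (HomogeneousIdeal.irrelevant (constGrading k A)).toIdeal ↔ (f : A[X]).coeff 0 = 0 := by
  rw [← monomial_eq_zero_iff _ 0, ← coe_decompose, ZeroMemClass.coe_eq_zero]
  rfl

theorem var_mem_irrelevant : var ∈ (HomogeneousIdeal.irrelevant (constGrading k A)).toIdeal :=
  mem_irrelevant_iff.mpr coeff_X_zero

theorem bijective_algebraMap_constGrading_zero [Nontrivial A] :
    Function.Bijective (algebraMap k (constGrading k A 0)) := by
  refine ⟨fun a b hab => (algebraMap k (constRing k A)).injective (congrArg Subtype.val hab), ?_⟩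
  rintro ⟨f, hf⟩
  obtain ⟨c, hc⟩ := mem_constGrading_zero.mp hf
  exact ⟨c, Subtype.ext hc.symm⟩

theorem isField_constGrading_zero [Nontrivial A] : IsField (constGrading k A 0) :=
  (RingEquiv.ofBijective (algebraMap k (constGrading k A 0))
    bijective_algebraMap_constGrading_zero).symm.toMulEquiv.isField (Field.toIsField k)

theorem isMaximal_irrelevant [Nontrivial A] :
    (HomogeneousIdeal.irrelevant (constGrading k A)).toIdeal.IsMaximal :=
  isMaximal_irrelevant_of_isField _ isField_constGrading_zero

theorem irrelevant_le_of_var_mem {p : Ideal (constRing k A)} [p.IsPrime] (hp : var ∈ p) :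
    (HomogeneousIdeal.irrelevant (constGrading k A)).toIdeal ≤ p := by
  intro f hf
  obtain ⟨g, hg⟩ := X_dvd_iff.mpr (mem_irrelevant_iff.mp hf)
  exact mem_of_algebraMap_eq_mul (S := A[X]) algebraMap_var_mul_mem_range hp hg

theorem eq_irrelevant_of_var_mem [Nontrivial A] {p : Ideal (constRing k A)} [hp : p.IsPrime]
    (hvar : var ∈ p) : p = (HomogeneousIdeal.irrelevant (constGrading k A)).toIdeal :=
  (isMaximal_irrelevant.eq_of_le hp.ne_top (irrelevant_le_of_var_mem hvar)).symm

theorem ringKrullDim_eq [Nontrivial A] : ringKrullDim (constRing k A) = ringKrullDim A[X] := by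
  apply le_antisymm
  · refine ringKrullDim_le_of_forall_isMaximal algebraMap_var_mul_mem_range fun p _ hvar => ?_
    rw [eq_irrelevant_of_var_mem hvar]
    exact isMaximal_irrelevant
  · have krullDim_le := krullDim_notMem_le_ringKrullDim
      (algebraMap_var_mul_mem_range (k := k) (A := A))
    exact ringKrullDim_polynomial_le_krullDim_X_notMem.trans krullDim_le

/-- The homogeneous prime `q[X] ∩ (k ⊕ ⨁_{n > 0} A x ^ n)` attached to a prime `q` of `A`. -/
noncomputable def homogeneousPrime (q : PrimeSpectrum A) :
    {p : PrimeSpectrum (constRing k A) // p.asIdeal.IsHomogeneous (constGrading k A)} :=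
  ⟨(⟨q.asIdeal.map C, Ideal.isPrime_map_C_of_isPrime⟩ : PrimeSpectrum A[X]).comap
      (algebraMap (constRing k A) A[X]), by
    intro n f hf
    refine Ideal.mem_map_C_iff.mpr fun i => ?_
    change coeff ((DirectSum.decompose (constGrading k A) f n : constRing k A) : A[X]) i ∈ _
    rw [coe_decompose, coeff_monomial]
    split_ifs
    · exact Ideal.mem_map_C_iff.mp hf n
    · exact zero_mem _⟩

theorem mem_homogeneousPrime {q : PrimeSpectrum A} {f : constRing k A} :
    f ∈ (homogeneousPrime q : {p : PrimeSpectrum (constRing k A) //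
      p.asIdeal.IsHomogeneous (constGrading k A)}).1.asIdeal ↔
      ∀ n, (f : A[X]).coeff n ∈ q.asIdeal :=
  Ideal.mem_map_C_iff

theorem var_notMem_homogeneousPrime (q : PrimeSpectrum A) :
    var ∉ (homogeneousPrime (k := k) q).1.asIdeal := fun h =>
  q.isPrime.ne_top <| (Ideal.eq_top_iff_one _).mpr <|
    coeff_X_one (R := A) ▸ mem_homogeneousPrime.mp h 1

theorem homogeneousPrime_le_homogeneousPrime {p q : PrimeSpectrum A} :
    homogeneousPrime (k := k) p ≤ homogeneousPrime q ↔ p ≤ q := by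
  refine ⟨fun h a ha => ?_, fun h f hf =>
    mem_homogeneousPrime.mpr fun n => h (mem_homogeneousPrime.mp hf n)⟩
  let f : constRing k A := ⟨monomial 1 a, monomial_mem_constRing one_pos a⟩
  have hf : f ∈ (homogeneousPrime p).1.asIdeal := mem_homogeneousPrime.mpr fun n => by
    rw [coeff_monomial]
    split_ifs
    · exact ha
    · exact zero_mem _
  exact coeff_monomial_same 1 a ▸ mem_homogeneousPrime.mp (h hf) 1

theorem exists_homogeneousPrime_eq
    {p : {p : PrimeSpectrum (constRing k A) // p.asIdeal.IsHomogeneous (constGrading k A)}}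
    (hp : var ∉ p.1.asIdeal) : ∃ q, homogeneousPrime q = p := by
  obtain ⟨P, hP, hPp⟩ :=
    exists_isPrime_comap_algebraMap_eq (S := A[X]) algebraMap_var_mul_mem_range hp
  have X_pow_notMem (n : ℕ) : X ^ n ∉ P := fun h =>
    hp (hPp ▸ (hP.mem_of_pow_mem n h : algebraMap (constRing k A) A[X] var ∈ P))
  refine ⟨PrimeSpectrum.comap C ⟨P, hP⟩, Subtype.ext (PrimeSpectrum.ext (Ideal.ext fun f => ?_))⟩
  rw [mem_homogeneousPrime, p.2.mem_iff]
  refine forall_congr' fun n => ?_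
  have decompose_eq : algebraMap (constRing k A) A[X] (DirectSum.decompose (constGrading k A) f n)
      = C ((f : A[X]).coeff n) * X ^ n := by
    rw [C_mul_X_pow_eq_monomial]
    exact coe_decompose f n
  rw [← hPp, Ideal.mem_comap, decompose_eq, hP.mul_mem_iff_mem_or_mem,
    or_iff_left (X_pow_notMem n)]
  rfl

theorem gradedKrullDim_eq [Nontrivial A] :
    gradedKrullDim (constGrading k A) = ringKrullDim A + 1 := by
  let irr : {p : PrimeSpectrum (constRing k A) // p.asIdeal.IsHomogeneous (constGrading k A)} :=
    ⟨⟨_, isMaximal_irrelevant.isPrime⟩,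
      (HomogeneousIdeal.irrelevant (constGrading k A)).isHomogeneous⟩
  refine krullDim_eq_add_one_of_forall_gt
    (OrderEmbedding.ofMapLEIff homogeneousPrime fun _ _ => homogeneousPrime_le_homogeneousPrime)
    irr (fun q => ?_) fun p hp => ?_
  · exact lt_of_le_not_ge
      (le_irrelevant_of_isHomogeneous_of_isField _ isField_constGrading_zero
        (homogeneousPrime q).2 (homogeneousPrime q).1.isPrime.ne_top)
      fun h => var_notMem_homogeneousPrime q (h var_mem_irrelevant)
  · have var_mem : var ∈ p.1.asIdeal := by
      by_contra h
      exact hp (exists_homogeneousPrime_eq h)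
    exact fun q hpq => ((eq_irrelevant_of_var_mem (hpq var_mem)).trans
      (eq_irrelevant_of_var_mem var_mem).symm).le

theorem finite_of_finite_constGrading {n : ℕ} (hn : 0 < n)
    [Module.Finite k (constGrading k A n)] : Module.Finite k A := by
  let coeffHom : constGrading k A n →ₗ[k] A := (lcoeff A n).restrictScalars k ∘ₗ
    (constRing k A).val.toLinearMap ∘ₗ (constGrading k A n).subtype
  exact Module.Finite.of_surjective coeffHom fun a =>
    ⟨⟨⟨monomial n a, monomial_mem_constRing hn a⟩, a, rfl⟩, coeff_monomial_same n a⟩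

theorem not_isHilbertSerre (hA : 0 < ringKrullDim A) : ¬IsHilbertSerre (constGrading k A) := by
  intro h
  have := h.finite 1
  have : Module.Finite k A := finite_of_finite_constGrading one_pos
  have : IsArtinianRing A := IsArtinianRing.of_finite k A
  exact hA.not_ge (Ring.krullDimLE_iff.mp inferInstance)

end constRing

theorem mainTheorem7 (k : Type u) [Field k] (d d' : ℕ) (hd : 1 ≤ d) (hd₁ : d + 2 ≤ d')
    (hd₂ : d' ≤ 2 * d + 1) :
    (∃ (A : Type u) (_ : CommRing A) (_ : IsDomain A) (_ : Algebra k A),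
      ringKrullDim A = d ∧ ringKrullDim A[X] = d') ∧
    (∀ (A : Type v) [CommRing A] [IsDomain A] [Algebra k A],
      ringKrullDim A = d → ringKrullDim A[X] = d' →
      IsDomain (constRing k A) ∧
      Function.Bijective (algebraMap k (constGrading k A 0)) ∧
      ¬ IsHilbertSerre (constGrading k A) ∧
      gradedKrullDim (constGrading k A) = d + 1 ∧
      ringKrullDim (constRing k A) = d' ∧
      gradedKrullDim (constGrading k A) < ringKrullDim (constRing k A)) := by
  refine ⟨?_, fun A _ _ _ dim_A dim_polynomial_A => ?_⟩
  · obtain ⟨m, j, rfl, rfl⟩ : ∃ m j, d = m + j ∧ d' = m + 1 + 2 * j :=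
      ⟨2 * d + 1 - d', d' - d - 1, by omega, by omega⟩
    exact exists_ringKrullDim_eq_and_ringKrullDim_polynomial_eq k m j
  · have graded_dim : gradedKrullDim (constGrading k A) = d + 1 := by
      rw [constRing.gradedKrullDim_eq, dim_A]
    have dim : ringKrullDim (constRing k A) = d' := by
      rw [constRing.ringKrullDim_eq, dim_polynomial_A]
    have dim_pos : 0 < ringKrullDim A := by
      rw [dim_A]
      exact_mod_cast hd
    refine ⟨inferInstance, constRing.bijective_algebraMap_constGrading_zero,
      constRing.not_isHilbertSerre dim_pos, graded_dim, dim, ?_⟩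
    rw [graded_dim, dim]
    exact_mod_cast hd₁
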